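/- Let $k\ge 3$ be a fixed integer. For a positive integer $n$ that is a multiple of $k$, let $\mathcal H_k=\mathcal H_k(n)$ be the set of all $k\times k$ matrices $\ell=(\ell_{ij})$ with nonnegative integer entries for which each row sum and each column sum equals $n/k$, and for real $c$ put $$A_n(c) := \frac{n^{k-1}}{k^{2n}}\left(1-\frac1k\right)^{-2nc}\sum_{\ell\in\mathcal H_k}\frac{n!}{\prod_{i,j}\ell_{ij}!}\left(1-\frac2k+\sum_{i,j}\left(\frac{\ell_{ij}}{n}\right)^2\right)^{nc}.$$ If $c$ is a fixed real number with $c<(k-1)\log(k-1)$, then $A_n(c)=O(1)$ as $n\to\infty$ through the multiples of $k$; that is, there is a constant $C$, depending only on $k$ and $c$, such that $A_n(c)\le C$ for all sufficiently large multiples $n$ of $k$. -/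

import Mathlib

open Filter Asymptotics

namespace AchlioptasNaor

/-- The finite set of all `k × k` matrices with nonnegative integer entries for which each row sum
and each column sum equals `n / k` (written as `k * sum = n`, so that no division occurs).
The bound `n` on the entries, which makes the set a `Finset`, is implied by the row sums, see
`mem_tables`. -/
def tables (k n : ℕ) : Finset (Fin k → Fin k → ℕ) :=
  (Fintype.piFinset fun _ : Fin k => Fintype.piFinset fun _ : Fin k => Finset.range (n + 1)).filter
    fun ℓ => (∀ i, k * ∑ j, ℓ i j = n) ∧ ∀ j, k * ∑ i, ℓ i j = n

theorem mem_tables {k n : ℕ} {ℓ : Fin k → Fin k → ℕ} :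
    ℓ ∈ tables k n ↔ (∀ i, k * ∑ j, ℓ i j = n) ∧ ∀ j, k * ∑ i, ℓ i j = n := by
  unfold tables
  rw [Finset.mem_filter]
  refine ⟨fun h => h.2, fun h => ⟨?_, h⟩⟩
  refine Fintype.mem_piFinset.2 fun i => Fintype.mem_piFinset.2 fun j => ?_
  rw [Finset.mem_range, Nat.lt_succ_iff]
  have hk : 0 < k := i.pos
  calc ℓ i j ≤ ∑ j', ℓ i j' := Finset.single_le_sum (fun _ _ => Nat.zero_le _) (Finset.mem_univ j)
    _ ≤ k * ∑ j', ℓ i j' := Nat.le_mul_of_pos_left _ hk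
    _ = n := h.1 i

/-- The ratio
`A_n(c) = n^(k-1) / k^(2n) * (1 - 1/k)^(-2nc)
  * ∑ ℓ, n! / (∏ i j, ℓ i j !) * (1 - 2/k + ∑ i j, (ℓ i j / n)^2)^(n c)`,
the sum running over `tables k n`; the powers with exponents `-2nc` and `nc` are real powers. -/
noncomputable def A (k : ℕ) (c : ℝ) (n : ℕ) : ℝ :=
  (n : ℝ) ^ (k - 1) / (k : ℝ) ^ (2 * n) * (1 - 1 / (k : ℝ)) ^ (-2 * (n : ℝ) * c) *
    ∑ ℓ ∈ tables k n,
      (n.factorial : ℝ) / (∏ i, ∏ j, ((ℓ i j).factorial : ℝ)) *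
        (1 - 2 / (k : ℝ) + ∑ i, ∑ j, ((ℓ i j : ℝ) / (n : ℝ)) ^ 2) ^ ((n : ℝ) * c)

end AchlioptasNaor

namespace AchlioptasNaor

theorem two_mul_sub_one_le_add_one_mul_log {u : ℝ} (hu : 1 ≤ u) :
    2 * (u - 1) ≤ (u + 1) * Real.log u := by
  have h := Real.le_log_one_add_of_nonneg (x := u - 1) (by linarith)
  rw [show 1 + (u - 1) = u by ring, show u - 1 + 2 = u + 1 by ring, div_le_iff₀ (by linarith)] at h
  linarith

theorem antitoneOn_mul_log_sub_div_sq :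
    AntitoneOn (fun u : ℝ => (u * Real.log u - u + 1) / (u - 1) ^ 2) (Set.Ioi 1) := by
  have hd : ∀ u ∈ Set.Ioi (1 : ℝ), HasDerivAt
      (fun u : ℝ => (u * Real.log u - u + 1) / (u - 1) ^ 2)
      ((2 * (u - 1) - (u + 1) * Real.log u) / (u - 1) ^ 3) u := by
    intro u hu
    have hu1 : (1 : ℝ) < u := hu
    have hne : u - 1 ≠ 0 := by linarith
    have h1 := (((Real.hasDerivAt_mul_log (by linarith : u ≠ 0)).sub (hasDerivAt_id u)).add_const
      (1 : ℝ)).div (((hasDerivAt_id u).sub_const (1 : ℝ)).pow 2) (pow_ne_zero 2 hne)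
    refine h1.congr_deriv ?_
    simp only [id, Pi.sub_apply, Pi.pow_apply]
    field_simp
    push_cast
    ring
  refine antitoneOn_of_deriv_nonpos (convex_Ioi 1)
    (fun u hu => (hd u hu).continuousAt.continuousWithinAt) ?_ ?_
  · rw [interior_Ioi]
    exact fun u hu => (hd u hu).differentiableAt.differentiableWithinAt
  · rw [interior_Ioi]
    intro u hu
    have hu1 : (1 : ℝ) < u := hu
    rw [(hd u hu).deriv]
    exact div_nonpos_of_nonpos_of_nonneg
      (by linarith [two_mul_sub_one_le_add_one_mul_log hu1.le]) (pow_nonneg (by linarith) 3)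

theorem half_sq_le_mul_log_sub {u : ℝ} (h0 : 0 ≤ u) (h1 : u ≤ 1) :
    1 / 2 * (u - 1) ^ 2 ≤ u * Real.log u - u + 1 := by
  have hanti : AntitoneOn (fun u : ℝ => u * Real.log u - u + 1 - 1 / 2 * (u - 1) ^ 2)
      (Set.Icc 0 1) := by
    have hd : ∀ u ∈ Set.Ioo (0 : ℝ) 1, HasDerivAt
        (fun u : ℝ => u * Real.log u - u + 1 - 1 / 2 * (u - 1) ^ 2) (Real.log u - (u - 1)) u := by
      intro u hu
      have h1 := (((Real.hasDerivAt_mul_log hu.1.ne').sub (hasDerivAt_id u)).add_const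
        (1 : ℝ)).sub ((((hasDerivAt_id u).sub_const (1 : ℝ)).pow 2).const_mul (1 / 2 : ℝ))
      refine h1.congr_deriv ?_
      simp only [id]
      push_cast
      ring
    refine antitoneOn_of_deriv_nonpos (convex_Icc 0 1) ?_ ?_ ?_
    · exact (((Real.continuous_mul_log.sub continuous_id).add continuous_const).sub
        (by fun_prop)).continuousOn
    · rw [interior_Icc]
      exact fun u hu => (hd u hu).differentiableAt.differentiableWithinAt
    · rw [interior_Icc]
      intro u hu
      rw [(hd u hu).deriv]
      linarith [Real.log_le_sub_one_of_pos hu.1]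
  have := hanti ⟨h0, h1⟩ (Set.right_mem_Icc.2 zero_le_one) h1
  simp only [Real.log_one] at this
  linarith

/-- A quadratic minorant of `u log u - u + 1` that is valid at `U ≥ 1` is valid on `[0, U]`. -/
theorem mul_sq_le_mul_log_sub {κ u U : ℝ} (h0 : 0 ≤ u) (hU : u ≤ U) (hκ : κ ≤ 1 / 2)
    (h : κ * (U - 1) ^ 2 ≤ U * Real.log U - U + 1) :
    κ * (u - 1) ^ 2 ≤ u * Real.log u - u + 1 := by
  rcases le_or_gt u 1 with hu | hu
  · exact (mul_le_mul_of_nonneg_right hκ (sq_nonneg _)).trans (half_sq_le_mul_log_sub h0 hu)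
  · have h1 := antitoneOn_mul_log_sub_div_sq hu (hu.trans_le hU) hU
    have h2 : κ ≤ (U * Real.log U - U + 1) / (U - 1) ^ 2 := by
      rwa [le_div_iff₀ (pow_pos (by linarith) 2)]
    rw [← le_div_iff₀ (pow_pos (by linarith) 2)]
    exact h2.trans h1

/-- The scaled form: a tangent-line bound for `y log y - α y ^ 2` at the point `m`. -/
theorem tangent_le_mul_log_sub {α m y U : ℝ} (hm : 0 ≤ m) (h0 : 0 ≤ y) (hU : y ≤ U * m)
    (hα : α * m ≤ 1 / 2) (h : α * m * (U - 1) ^ 2 ≤ U * Real.log U - U + 1) :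
    m * Real.log m - α * m ^ 2 + (Real.log m + 1 - 2 * α * m) * (y - m) ≤
      y * Real.log y - α * y ^ 2 := by
  rcases hm.eq_or_lt with rfl | hm
  · have : y = 0 := le_antisymm (by simpa using hU) h0
    simp [this]
  have h1 := mul_sq_le_mul_log_sub (u := y / m) (div_nonneg h0 hm.le) ((div_le_iff₀ hm).2 hU) hα h
  have h2 : y / m * Real.log (y / m) = y / m * (Real.log y - Real.log m) := by
    rcases h0.eq_or_lt with rfl | h0
    · simp
    · rw [Real.log_div h0.ne' hm.ne']
  rw [h2] at h1
  have h3 := mul_le_mul_of_nonneg_left h1 hm.le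
  have e1 : m * (α * m * (y / m - 1) ^ 2) = α * (y - m) ^ 2 := by field_simp
  have e2 : m * (y / m * (Real.log y - Real.log m) - y / m + 1) =
      y * (Real.log y - Real.log m) - y + m := by field_simp
  rw [e1, e2] at h3
  nlinarith

theorem log_le_half {s : ℝ} (hs : 0 < s) : Real.log s ≤ s / 2 := by
  have h := Real.log_le_sub_one_of_pos (half_pos hs)
  rw [Real.log_div hs.ne' two_ne_zero] at h
  linarith [Real.log_two_lt_d9]

theorem mul_log_le_mul_log_of_pow_le {a b : ℝ} {p q : ℕ} (ha : 0 < a) (h : a ^ p ≤ b ^ q) :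
    p * Real.log a ≤ q * Real.log b := by
  have := Real.log_le_log (pow_pos ha p) h
  rwa [Real.log_pow, Real.log_pow] at this

theorem sq_mul_log_sub_one_le_of_eight_le {x : ℝ} (hx : 8 ≤ x) :
    (x - 2) ^ 2 * Real.log (x - 1) ≤ 2 * (x - 1) * (x * Real.log (x / 2) - x + 2) := by
  have hx0 : 0 < x := by linarith
  have h1 : Real.log (x - 1) ≤ Real.log x - 1 / x := by
    have h := Real.log_le_sub_one_of_pos (x := (x - 1) / x) (div_pos (by linarith) hx0)
    rw [Real.log_div (by linarith) hx0.ne'] at h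
    have : (x - 1) / x - 1 = - (1 / x) := by field_simp; ring
    linarith
  have h2 : 3 * Real.log 2 + 2 * (x - 8) / (x + 8) ≤ Real.log x := by
    have h := two_mul_sub_one_le_add_one_mul_log (u := x / 8) (by linarith)
    have h8 : Real.log (x / 8) = Real.log x - 3 * Real.log 2 := by
      rw [Real.log_div hx0.ne' (by norm_num), show (8 : ℝ) = 2 ^ 3 by norm_num, Real.log_pow]
      norm_num
    rw [h8] at h
    have : 2 * (x - 8) / (x + 8) ≤ Real.log x - 3 * Real.log 2 := by
      rw [div_le_iff₀ (by linarith)]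
      linarith
    linarith
  rw [Real.log_div hx0.ne' two_ne_zero]
  have hl2 := Real.log_two_gt_d9
  set t := Real.log 2
  have h3 : (x - 2) ^ 2 * Real.log (x - 1) ≤ (x - 2) ^ 2 * (Real.log x - 1 / x) :=
    mul_le_mul_of_nonneg_left h1 (sq_nonneg _)
  have h4 : (x ^ 2 + 2 * x - 4) * (3 * t + 2 * (x - 8) / (x + 8)) ≤
      (x ^ 2 + 2 * x - 4) * Real.log x :=
    mul_le_mul_of_nonneg_left h2 (by nlinarith)
  have h5 : 0 ≤ t * (x ^ 2 + 8 * x - 12) + (x ^ 2 + 2 * x - 4) * (2 * (x - 8) / (x + 8))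
      - 2 * (x - 1) * (x - 2) + (x - 2) ^ 2 * (1 / x) := by
    have h6 : 0 ≤ (69 / 100) * (x ^ 2 + 8 * x - 12) + (x ^ 2 + 2 * x - 4) * (2 * (x - 8) / (x + 8))
      - 2 * (x - 1) * (x - 2) + (x - 2) ^ 2 * (1 / x) := by
      have : (69 / 100) * (x ^ 2 + 8 * x - 12) + (x ^ 2 + 2 * x - 4) * (2 * (x - 8) / (x + 8))
        - 2 * (x - 1) * (x - 2) + (x - 2) ^ 2 * (1 / x) =
        ((69 / 100) * (x ^ 2 + 8 * x - 12) * (x * (x + 8)) + (x ^ 2 + 2 * x - 4) * (2 * (x - 8)) * x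
        - 2 * (x - 1) * (x - 2) * (x * (x + 8)) + (x - 2) ^ 2 * (x + 8)) / (x * (x + 8)) := by
        have : x + 8 ≠ 0 := by linarith
        field_simp
      rw [this]
      refine div_nonneg ?_ (by nlinarith)
      obtain ⟨d, rfl⟩ : ∃ d, x = 8 + d := ⟨x - 8, by ring⟩
      have hd : 0 ≤ d := by linarith
      ring_nf
      positivity
    nlinarith [mul_le_mul_of_nonneg_right (show 69 / 100 ≤ t by linarith)
      (show 0 ≤ x ^ 2 + 8 * x - 12 by nlinarith)]
  nlinarith

theorem sq_mul_log_sub_one_le {k : ℕ} (hk : 3 ≤ k) :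
    ((k : ℝ) - 2) ^ 2 * Real.log (k - 1) ≤
      2 * ((k : ℝ) - 1) * (k * Real.log (k / 2) - k + 2) := by
  rcases le_or_gt 8 k with h8 | h8
  · exact sq_mul_log_sub_one_le_of_eight_le (by exact_mod_cast h8)
  have l2 := Real.log_two_gt_d9
  have l2' := Real.log_two_lt_d9
  have a3 := mul_log_le_mul_log_of_pow_le (a := 2) (b := 3) (p := 19) (q := 12) (by norm_num)
    (by norm_num)
  have b3 := mul_log_le_mul_log_of_pow_le (a := 3) (b := 2) (p := 29) (q := 46) (by norm_num)
    (by norm_num)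
  have a5 := mul_log_le_mul_log_of_pow_le (a := 2) (b := 5) (p := 65) (q := 28) (by norm_num)
    (by norm_num)
  have b5 := mul_log_le_mul_log_of_pow_le (a := 5) (b := 2) (p := 31) (q := 72) (by norm_num)
    (by norm_num)
  have a7 := mul_log_le_mul_log_of_pow_le (a := 2) (b := 7) (p := 87) (q := 31) (by norm_num)
    (by norm_num)
  have e6 : Real.log 6 = Real.log 2 + Real.log 3 := by
    rw [← Real.log_mul (by norm_num) (by norm_num)]; norm_num
  have e4 : Real.log 4 = 2 * Real.log 2 := by
    rw [show (4 : ℝ) = 2 ^ 2 by norm_num, Real.log_pow]; norm_num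
  have hk0 : (k : ℝ) ≠ 0 := by positivity
  rw [Real.log_div hk0 two_ne_zero]
  push_cast at a3 b3 a5 b5 a7
  interval_cases k <;> norm_num [e6, e4] <;> linarith

theorem two_mul_log_le_sub_inv {r : ℝ} (hr : 1 ≤ r) : 2 * Real.log r ≤ r - r⁻¹ := by
  have h := Real.self_le_sinh_iff.2 (Real.log_nonneg hr)
  rw [Real.sinh_log (by linarith)] at h
  linarith

theorem monotoneOn_log_mul_div :
    MonotoneOn (fun r : ℝ => Real.log r * (r + 1) / (r - 1)) (Set.Ioi 1) := by
  have hd : ∀ r ∈ Set.Ioi (1 : ℝ), HasDerivAt (fun r : ℝ => Real.log r * (r + 1) / (r - 1))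
      ((r - r⁻¹ - 2 * Real.log r) / (r - 1) ^ 2) r := by
    intro r hr
    have hr1 : (1 : ℝ) < r := hr
    have hne : r - 1 ≠ 0 := by linarith
    have hr0 : r ≠ 0 := by linarith
    have h1 := ((Real.hasDerivAt_log hr0).mul ((hasDerivAt_id r).add_const (1 : ℝ))).div
      ((hasDerivAt_id r).sub_const (1 : ℝ)) hne
    refine h1.congr_deriv ?_
    simp only [id, Pi.mul_apply]
    field_simp
    ring
  refine monotoneOn_of_deriv_nonneg (convex_Ioi 1)
    (fun u hu => (hd u hu).continuousAt.continuousWithinAt) ?_ ?_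
  · rw [interior_Ioi]
    exact fun u hu => (hd u hu).differentiableAt.differentiableWithinAt
  · rw [interior_Ioi]
    intro u hu
    have hu1 : (1 : ℝ) < u := hu
    rw [(hd u hu).deriv]
    exact div_nonneg (by linarith [two_mul_log_le_sub_inv hu1.le]) (sq_nonneg _)

theorem hasDerivAt_binEntropy_sub (γ : ℝ) {x : ℝ} (hx : x ∈ Set.Ioo (0 : ℝ) (1 / 2)) :
    HasDerivAt (fun x => Real.binEntropy x - γ * (x * (1 - x)))
      ((Real.log ((1 - x) / x) * ((1 - x) / x + 1) / ((1 - x) / x - 1) - γ) * (1 - 2 * x)) x := by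
  obtain ⟨h0, h1⟩ := hx
  have h := (Real.hasDerivAt_binEntropy h0.ne' (by linarith)).sub
    (((hasDerivAt_id x).mul ((hasDerivAt_id x).const_sub 1)).const_mul γ)
  refine h.congr_deriv ?_
  rw [Real.log_div (by linarith) h0.ne']
  have e : (1 - x) / x - 1 = (1 - 2 * x) / x := by field_simp; ring
  rw [e]
  have hne : 1 - 2 * x ≠ 0 := by linarith
  have e2 : (1 - x) / x + 1 = 1 / x := by field_simp; ring
  have e3 : (Real.log (1 - x) - Real.log x) * (1 / x) / ((1 - 2 * x) / x) * (1 - 2 * x) =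
      Real.log (1 - x) - Real.log x := by
    rw [mul_one_div, div_div_div_cancel_right₀ h0.ne', div_mul_cancel₀ _ hne]
  rw [e2, sub_mul, e3]
  simp only [id]
  ring

theorem continuous_binEntropy_sub (γ : ℝ) :
    Continuous (fun x => Real.binEntropy x - γ * (x * (1 - x))) :=
  Real.binEntropy_continuous.sub (by fun_prop)

/-- On `[0, 1/2]`, the function `binEntropy x - γ x (1 - x)` is maximal at its critical point. -/
theorem binEntropy_sub_le {s x : ℝ} (hs : 1 < s) (h0 : 0 ≤ x) (h1 : x ≤ 1 / 2) :
    Real.binEntropy x - Real.log s * (s + 1) / (s - 1) * (x * (1 - x)) ≤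
      Real.binEntropy (1 / (s + 1)) -
        Real.log s * (s + 1) / (s - 1) * (1 / (s + 1) * (1 - 1 / (s + 1))) := by
  set γ := Real.log s * (s + 1) / (s - 1) with hγ
  have hs0 : 0 < s + 1 := by linarith
  have hm0 : 0 < 1 / (s + 1) := by positivity
  have hm1 : 1 / (s + 1) < 1 / 2 := one_div_lt_one_div_of_lt two_pos (by linarith)
  rcases le_total x (1 / (s + 1)) with hx | hx
  · have hmono : MonotoneOn (fun x => Real.binEntropy x - γ * (x * (1 - x)))
        (Set.Icc 0 (1 / (s + 1))) := by
      refine monotoneOn_of_deriv_nonneg (convex_Icc _ _)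
        (continuous_binEntropy_sub γ).continuousOn ?_ ?_ <;> rw [interior_Icc]
      · exact fun u hu => (hasDerivAt_binEntropy_sub γ
          ⟨hu.1, hu.2.trans hm1⟩).differentiableAt.differentiableWithinAt
      · intro u hu
        rw [(hasDerivAt_binEntropy_sub γ ⟨hu.1, hu.2.trans hm1⟩).deriv]
        have hsu : s ≤ (1 - u) / u := by
          rw [le_div_iff₀ hu.1]
          have := (lt_div_iff₀ hs0).1 hu.2
          linarith
        have := monotoneOn_log_mul_div (a := s) (b := (1 - u) / u) hs (hs.trans_le hsu) hsu
        exact mul_nonneg (sub_nonneg.2 this) (by linarith [hu.2])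
    exact hmono ⟨h0, hx⟩ ⟨hm0.le, le_rfl⟩ hx
  · have hanti : AntitoneOn (fun x => Real.binEntropy x - γ * (x * (1 - x)))
        (Set.Icc (1 / (s + 1)) (1 / 2)) := by
      refine antitoneOn_of_deriv_nonpos (convex_Icc _ _)
        (continuous_binEntropy_sub γ).continuousOn ?_ ?_ <;> rw [interior_Icc]
      · exact fun u hu => (hasDerivAt_binEntropy_sub γ
          ⟨hm0.trans hu.1, hu.2⟩).differentiableAt.differentiableWithinAt
      · intro u hu
        have hu0 := hm0.trans hu.1
        rw [(hasDerivAt_binEntropy_sub γ ⟨hu0, hu.2⟩).deriv]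
        have hsu : (1 - u) / u ≤ s := by
          rw [div_le_iff₀ hu0]
          have := (div_lt_iff₀ hs0).1 hu.1
          linarith
        have h1u : 1 < (1 - u) / u := by
          rw [lt_div_iff₀ hu0]
          linarith [hu.2]
        have := monotoneOn_log_mul_div (a := (1 - u) / u) (b := s) h1u hs hsu
        exact mul_nonpos_of_nonpos_of_nonneg (sub_nonpos.2 this) (by linarith [hu.2])
    exact hanti ⟨le_rfl, hm1.le⟩ ⟨hx, h1⟩ hx

/-- The case of one large entry `1 - x`, the remaining mass `x` being spread uniformly. -/
theorem two_level_bound {s x : ℝ} (hs : 2 ≤ s) (h0 : 0 ≤ x) (h1 : x ≤ 1 / 2) :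
    0 ≤ (1 - x) * Real.log (1 - x) - (s + 1) * Real.log s / s * (1 - x) ^ 2 +
      s * (x / s * Real.log (x / s) - (s + 1) * Real.log s / s * (x / s) ^ 2) +
      Real.log (s + 1) + Real.log s / s := by
  have h := binEntropy_sub_le (s := s) (by linarith) h0 h1
  have hs0 : 0 < s := by linarith
  have hL : 0 ≤ Real.log s := Real.log_nonneg (by linarith)
  have hx : x / s * Real.log (x / s) = x / s * (Real.log x - Real.log s) := by
    rcases h0.eq_or_lt with rfl | h0
    · simp
    · rw [Real.log_div h0.ne' hs0.ne']
  have e1 : (1 : ℝ) - 1 / (s + 1) = s / (s + 1) := by field_simp; ring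
  rw [Real.binEntropy, Real.binEntropy, e1] at h
  simp only [Real.log_inv] at h
  rw [Real.log_div hs0.ne' (by linarith), Real.log_div one_ne_zero (by linarith),
    Real.log_one] at h
  rw [hx]
  set L := Real.log s
  set K := Real.log (s + 1)
  have hs1 : 0 < s - 1 := by linarith
  have key : (1 - x) * Real.log (1 - x) - (s + 1) * L / s * (1 - x) ^ 2 +
      s * (x / s * (Real.log x - L) - (s + 1) * L / s * (x / s) ^ 2) + K + L / s =
      (1 / (s + 1) * -(0 - K) + s / (s + 1) * -(L - K) -
        L * (s + 1) / (s - 1) * (1 / (s + 1) * (s / (s + 1)))) -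
      (x * -Real.log x + (1 - x) * -Real.log (1 - x) - L * (s + 1) / (s - 1) * (x * (1 - x))) +
      L * (s + 1) / (s ^ 2 * (s - 1)) * (s / (s + 1) - x) ^ 2 := by
    field_simp
    ring
  rw [key]
  have : 0 ≤ L * (s + 1) / (s ^ 2 * (s - 1)) * (s / (s + 1) - x) ^ 2 := by
    positivity
  linarith

theorem sum_tangent_le {ι : Type*} (t : Finset ι) (p : ι → ℝ) (α m U : ℝ) (hm : 0 ≤ m)
    (hp : ∀ i ∈ t, 0 ≤ p i) (hU : ∀ i ∈ t, p i ≤ U * m) (hα : α * m ≤ 1 / 2)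
    (h : α * m * (U - 1) ^ 2 ≤ U * Real.log U - U + 1) (hs : ∑ i ∈ t, p i = t.card * m) :
    t.card * (m * Real.log m - α * m ^ 2) ≤ ∑ i ∈ t, (p i * Real.log (p i) - α * p i ^ 2) := by
  have h1 := Finset.sum_le_sum fun i hi =>
    tangent_le_mul_log_sub hm (hp i hi) (hU i hi) hα h
  have hz : ∑ i ∈ t, (p i - m) = 0 := by
    rw [Finset.sum_sub_distrib, hs, Finset.sum_const, nsmul_eq_mul, sub_self]
  rwa [Finset.sum_add_distrib, ← Finset.mul_sum, hz, mul_zero, add_zero, Finset.sum_const,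
    nsmul_eq_mul] at h1

/-- The relative entropy of a probability vector with respect to the uniform distribution
dominates a multiple of the squared Euclidean distance. -/
theorem sum_sq_sub_le_log_add_sum_mul_log {k : ℕ} (hk : 3 ≤ k) (p : Fin k → ℝ)
    (hp : ∀ i, 0 ≤ p i) (hs : ∑ i, p i = 1) :
    (k : ℝ) * Real.log (k - 1) / (k - 1) * (∑ i, p i ^ 2 - 1 / k) ≤
      Real.log k + ∑ i, p i * Real.log (p i) := by
  have hk3 : (3 : ℝ) ≤ k := by exact_mod_cast hk
  set α := (k : ℝ) * Real.log (k - 1) / (k - 1) with hα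
  have hL0 : 0 ≤ Real.log ((k : ℝ) - 1) := Real.log_nonneg (by linarith)
  have hLh : Real.log ((k : ℝ) - 1) ≤ ((k : ℝ) - 1) / 2 := log_le_half (by linarith)
  have hk1 : 0 < (k : ℝ) - 1 := by linarith
  have hk0 : (0 : ℝ) < k := by linarith
  suffices H : -(Real.log k) - α / k ≤ ∑ i, (p i * Real.log (p i) - α * p i ^ 2) by
    rw [Finset.sum_sub_distrib, ← Finset.mul_sum] at H
    have : α * (∑ i, p i ^ 2 - 1 / k) = α * ∑ i, p i ^ 2 - α / k := by ring
    linarith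
  by_cases hM : ∀ i, p i ≤ 1 / 2
  · have e1 : α * (1 / k) = Real.log ((k : ℝ) - 1) / (k - 1) := by
      rw [hα]; field_simp
    have := sum_tangent_le Finset.univ p α (1 / k) (k / 2) (by positivity) (fun i _ => hp i)
      (fun i _ => (hM i).trans_eq (by field_simp)) ?_ ?_ ?_
    · refine le_trans (le_of_eq ?_) this
      rw [Finset.card_univ, Fintype.card_fin, one_div, Real.log_inv]
      field_simp
    · rw [e1, div_le_iff₀ hk1]
      linarith
    · rw [e1, div_mul_eq_mul_div, div_le_iff₀ hk1]
      have := sq_mul_log_sub_one_le hk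
      nlinarith
    · rw [hs, Finset.card_univ, Fintype.card_fin]
      field_simp
  · push Not at hM
    obtain ⟨i₀, hi₀⟩ := hM
    set x := 1 - p i₀ with hx
    have hsum := Finset.add_sum_erase Finset.univ p (Finset.mem_univ i₀)
    rw [hs] at hsum
    have hx0 : 0 ≤ x := by
      have := Finset.sum_nonneg fun i (_ : i ∈ Finset.univ.erase i₀) => hp i
      linarith
    have hcard : ((Finset.univ.erase i₀).card : ℝ) = k - 1 := by
      rw [Finset.card_erase_of_mem (Finset.mem_univ _), Finset.card_univ, Fintype.card_fin,
        Nat.cast_sub (by omega), Nat.cast_one]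
    have e1 : α * (x / (k - 1)) ≤
        (k : ℝ) * Real.log (k - 1) / (2 * ((k : ℝ) - 1) ^ 2) := by
      calc α * (x / (k - 1)) ≤ α * (1 / 2 / (k - 1)) := by
            refine mul_le_mul_of_nonneg_left ?_ (by positivity)
            exact div_le_div_of_nonneg_right (by linarith) hk1.le
        _ = _ := by rw [hα]; field_simp
    have := sum_tangent_le (Finset.univ.erase i₀) p α (x / (k - 1)) (k - 1)
      (div_nonneg hx0 hk1.le) (fun i _ => hp i) ?_ ?_ ?_ ?_
    · rw [← Finset.add_sum_erase _ _ (Finset.mem_univ i₀)]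
      have h2 := two_level_bound (s := (k : ℝ) - 1) (by linarith) hx0 (by linarith)
      rw [hcard] at this
      have e2 : 1 - x = p i₀ := by rw [hx]; ring
      rw [e2, sub_add_cancel, ← hα] at h2
      have e3 : Real.log ((k : ℝ) - 1) / (k - 1) = α / k := by rw [hα]; field_simp
      linarith
    · intro i hi
      rw [mul_div_cancel₀ _ hk1.ne']
      have := Finset.single_le_sum (fun i _ => hp i) hi
      linarith
    · refine e1.trans ?_
      rw [div_le_iff₀ (by positivity)]
      nlinarith
    · refine (mul_le_mul_of_nonneg_right e1 (sq_nonneg _)).trans ?_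
      have h3 := two_mul_sub_one_le_add_one_mul_log (u := (k : ℝ) - 1) (by linarith)
      rw [div_mul_eq_mul_div, div_le_iff₀ (by positivity)]
      obtain ⟨s, hs'⟩ : ∃ s : ℝ, (k : ℝ) = s + 1 := ⟨k - 1, by ring⟩
      rw [hs'] at h3 hL0 hk1 hk3 ⊢
      simp only [add_sub_cancel_right] at h3 hL0 hk1 ⊢
      set L := Real.log s
      have h4 : 0 ≤ (s ^ 2) * ((s + 1) * L - 2 * (s - 1)) :=
        mul_nonneg (sq_nonneg _) (by linarith)
      have h5 : 0 ≤ (s - 1) * L := mul_nonneg (by linarith) hL0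
      nlinarith
    · rw [hcard, mul_div_cancel₀ _ hk1.ne']
      linarith

theorem factorial_le_exp_mul_sqrt_mul_pow {n : ℕ} (hn : n ≠ 0) :
    (n.factorial : ℝ) ≤ Real.exp 1 * √n * (n / Real.exp 1) ^ n := by
  obtain ⟨m, rfl⟩ := Nat.exists_eq_succ_of_ne_zero hn
  have h : Stirling.stirlingSeq (m + 1) ≤ Stirling.stirlingSeq 1 :=
    Stirling.stirlingSeq'_antitone (Nat.zero_le m)
  rw [Stirling.stirlingSeq_one, Stirling.stirlingSeq, div_le_iff₀ (by positivity),
    Real.sqrt_mul (by norm_num)] at h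
  refine h.trans_eq ?_
  have : √(2 : ℝ) ≠ 0 := by positivity
  field_simp

theorem sqrt_mul_pow_le_factorial (l : ℕ) :
    √(l + 1) * (l / Real.exp 1) ^ l ≤ (l.factorial : ℝ) := by
  rcases Nat.eq_zero_or_pos l with rfl | hl
  · simp
  · refine le_trans ?_ (Stirling.le_factorial_stirling l)
    have h1 : (1 : ℝ) ≤ l := by exact_mod_cast hl
    refine mul_le_mul_of_nonneg_right (Real.sqrt_le_sqrt ?_) (by positivity)
    nlinarith [Real.pi_gt_three]

theorem div_exp_pow_eq {n : ℕ} (hn : n ≠ 0) (l : ℕ) :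
    ((l : ℝ) / Real.exp 1) ^ l = (n / Real.exp 1) ^ l * Real.exp (l * Real.log (l / n)) := by
  have hn' : (n : ℝ) ≠ 0 := by exact_mod_cast hn
  rcases Nat.eq_zero_or_pos l with rfl | hl
  · simp
  · have hl' : (0 : ℝ) < l := by exact_mod_cast hl
    rw [Real.exp_nat_mul, Real.exp_log (by positivity), ← mul_pow]
    congr 1
    field_simp

/-- The entropy bound for multinomial coefficients, with the polynomial factors. -/
theorem factorial_div_prod_le {ι : Type*} [Fintype ι] {n : ℕ} (hn : n ≠ 0) (l : ι → ℕ)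
    (hl : ∑ i, l i = n) :
    (n.factorial : ℝ) / ∏ i, ((l i).factorial : ℝ) ≤
      Real.exp 1 * √n * ∏ i, ((√((l i : ℝ) + 1))⁻¹ * Real.exp (-(l i * Real.log (l i / n)))) := by
  have hn' : (0 : ℝ) < n := by exact_mod_cast Nat.pos_of_ne_zero hn
  have h1 : (∏ i, √((l i : ℝ) + 1)) * ((n / Real.exp 1) ^ n *
      ∏ i, Real.exp (l i * Real.log (l i / n))) ≤ ∏ i, ((l i).factorial : ℝ) := by
    have h := Finset.prod_le_prod (s := Finset.univ) (fun i _ => by positivity)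
      fun i _ => sqrt_mul_pow_le_factorial (l i)
    simp only [div_exp_pow_eq hn, Finset.prod_mul_distrib, Finset.prod_pow_eq_pow_sum] at h
    rwa [hl] at h
  rw [div_le_iff₀ (Finset.prod_pos fun i _ => by positivity)]
  refine (factorial_le_exp_mul_sqrt_mul_pow hn).trans ?_
  refine le_trans (le_of_eq ?_) (mul_le_mul_of_nonneg_left h1 (by positivity))
  simp only [Real.exp_neg, Finset.prod_mul_distrib, Finset.prod_inv_distrib]
  have h2 : (∏ i, √((l i : ℝ) + 1)) ≠ 0 := Finset.prod_ne_zero_iff.2 fun i _ => by positivity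
  have h3 : (∏ i, Real.exp (l i * Real.log (l i / n))) ≠ 0 :=
    Finset.prod_ne_zero_iff.2 fun i _ => by positivity
  field_simp

theorem sum_range_one_div_one_add_sq_le {τ : ℝ} (hτ : 0 < τ) (N : ℕ) :
    ∑ d ∈ Finset.range N, 1 / (1 + (d * τ) ^ 2) ≤ 1 + 2 / τ := by
  have h : ∀ N : ℕ, ∑ d ∈ Finset.range (N + 1), 1 / (1 + (d * τ) ^ 2) ≤
      1 + 2 / τ * (1 - 1 / (1 + N * τ)) := by
    intro N
    induction N with
    | zero => simp
    | succ N ih =>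
      rw [Finset.sum_range_succ]
      have ha : 0 ≤ (N : ℝ) * τ := by positivity
      have step : 1 / (1 + (((N + 1 : ℕ) : ℝ) * τ) ^ 2) ≤
          2 / τ * (1 / (1 + N * τ) - 1 / (1 + ((N + 1 : ℕ) : ℝ) * τ)) := by
        have e : 2 / τ * (1 / (1 + N * τ) - 1 / (1 + ((N + 1 : ℕ) : ℝ) * τ)) =
            2 / ((1 + N * τ) * (1 + ((N + 1 : ℕ) : ℝ) * τ)) := by
          push_cast
          have : 1 + (N : ℝ) * τ ≠ 0 := by positivity
          have : 1 + ((N : ℝ) + 1) * τ ≠ 0 := by positivity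
          field_simp
          ring
        rw [e, div_le_div_iff₀ (by positivity) (by positivity)]
        push_cast
        nlinarith [sq_nonneg (((N : ℝ) + 1) * τ - 1)]
      linarith
  refine (Finset.sum_le_sum_of_subset_of_nonneg
    (Finset.range_mono (Nat.le_succ N)) fun i _ _ => by positivity).trans ((h N).trans ?_)
  have : 0 ≤ 2 / τ * (1 / (1 + N * τ)) := by positivity
  nlinarith

theorem exp_neg_sq_le {τ x d : ℝ} (hd : 0 ≤ d) (h : d ≤ |x|) :
    Real.exp (-(τ ^ 2 * x ^ 2)) ≤ 1 / (1 + (d * τ) ^ 2) := by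
  have h1 : d ^ 2 ≤ x ^ 2 := by
    rw [← sq_abs x]
    exact pow_le_pow_left₀ hd h 2
  rw [Real.exp_neg, ← one_div]
  refine one_div_le_one_div_of_le (by positivity) ?_
  have := Real.add_one_le_exp (τ ^ 2 * x ^ 2)
  nlinarith [mul_le_mul_of_nonneg_left h1 (sq_nonneg τ)]

/-- Gaussian sums over the integers are at most of the order of the standard deviation. -/
theorem sum_range_exp_neg_sq_le {τ μ : ℝ} (hτ : 0 < τ) (hμ : 0 ≤ μ) (N : ℕ) :
    ∑ m ∈ Finset.range N, Real.exp (-(τ ^ 2 * (m - μ) ^ 2)) ≤ 2 * (1 + 2 / τ) := by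
  set M := ⌊μ⌋₊
  have hM : (M : ℝ) ≤ μ := Nat.floor_le hμ
  have hM' : μ < M + 1 := Nat.lt_floor_add_one μ
  calc ∑ m ∈ Finset.range N, Real.exp (-(τ ^ 2 * (m - μ) ^ 2))
      ≤ ∑ m ∈ Finset.range (M + 1 + N), Real.exp (-(τ ^ 2 * ((m : ℝ) - μ) ^ 2)) :=
        Finset.sum_le_sum_of_subset_of_nonneg (Finset.range_mono (by omega))
          fun i _ _ => (Real.exp_pos _).le
    _ = ∑ m ∈ Finset.range (M + 1), Real.exp (-(τ ^ 2 * ((m : ℝ) - μ) ^ 2)) +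
        ∑ d ∈ Finset.range N, Real.exp (-(τ ^ 2 * (((M + 1 + d : ℕ) : ℝ) - μ) ^ 2)) :=
        Finset.sum_range_add _ _ _
    _ ≤ ∑ m ∈ Finset.range (M + 1), 1 / (1 + (((M + 1 - 1 - m : ℕ) : ℝ) * τ) ^ 2) +
        ∑ d ∈ Finset.range N, 1 / (1 + ((d : ℝ) * τ) ^ 2) := by
        refine add_le_add (Finset.sum_le_sum fun m hm => ?_) (Finset.sum_le_sum fun d _ => ?_)
        · have hm' : m ≤ M := Nat.lt_succ_iff.1 (Finset.mem_range.1 hm)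
          refine exp_neg_sq_le (Nat.cast_nonneg _) ?_
          rw [abs_sub_comm, Nat.add_sub_cancel, Nat.cast_sub hm']
          exact le_trans (by linarith) (le_abs_self _)
        · refine exp_neg_sq_le (Nat.cast_nonneg _) (le_trans ?_ (le_abs_self _))
          push_cast
          linarith
    _ = ∑ m ∈ Finset.range (M + 1), 1 / (1 + ((m : ℝ) * τ) ^ 2) +
        ∑ d ∈ Finset.range N, 1 / (1 + ((d : ℝ) * τ) ^ 2) := by
        rw [Finset.sum_range_reflect (fun m : ℕ => 1 / (1 + ((m : ℝ) * τ) ^ 2)) (M + 1)]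
    _ ≤ 2 * (1 + 2 / τ) := by
        linarith [sum_range_one_div_one_add_sq_le hτ (M + 1), sum_range_one_div_one_add_sq_le hτ N]

/-- A table is determined by its leading block, so a sum of products of weights in `[0, 1]` over
all tables is at most a power of the sum of the weights. -/
theorem sum_tables_prod_le (K n : ℕ) (g : ℕ → ℝ) (h0 : ∀ m, 0 ≤ g m) (h1 : ∀ m, g m ≤ 1) :
    ∑ l ∈ tables (K + 1) n, ∏ i, ∏ j, g (l i j) ≤
      (∑ m ∈ Finset.range (n + 1), g m) ^ (K ^ 2) := by
  let f : (Fin (K + 1) → Fin (K + 1) → ℕ) → (Fin K → Fin K → ℕ) :=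
    fun l i j => l i.castSucc j.castSucc
  have hf : Set.InjOn f (tables (K + 1) n) := by
    intro l hl l' hl' h
    have hl := mem_tables.1 (Finset.mem_coe.1 hl)
    have hl' := mem_tables.1 (Finset.mem_coe.1 hl')
    have hblock : ∀ i j : Fin K, l i.castSucc j.castSucc = l' i.castSucc j.castSucc :=
      fun i j => congrFun (congrFun h i) j
    have hrow : ∀ i : Fin K, ∀ j, l i.castSucc j = l' i.castSucc j := by
      intro i j
      refine Fin.lastCases ?_ (fun j => hblock i j) j
      have h1 := Nat.eq_of_mul_eq_mul_left (Nat.succ_pos K)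
        ((hl.1 i.castSucc).trans (hl'.1 i.castSucc).symm)
      rw [Fin.sum_univ_castSucc, Fin.sum_univ_castSucc,
        Finset.sum_congr rfl fun j _ => hblock i j] at h1
      exact Nat.add_left_cancel h1
    funext i j
    refine Fin.lastCases ?_ (fun i => hrow i j) i
    have h1 := Nat.eq_of_mul_eq_mul_left (Nat.succ_pos K) ((hl.2 j).trans (hl'.2 j).symm)
    rw [Fin.sum_univ_castSucc, Fin.sum_univ_castSucc,
      Finset.sum_congr rfl fun i _ => hrow i j] at h1
    exact Nat.add_left_cancel h1
  have hle : ∀ l : Fin (K + 1) → Fin (K + 1) → ℕ,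
      ∏ i, ∏ j, g (l i j) ≤ ∏ i, ∏ j, g (f l i j) := by
    intro l
    have hinner : ∀ i, ∏ j, g (l i j) ≤ ∏ j : Fin K, g (l i j.castSucc) := fun i => by
      rw [Fin.prod_univ_castSucc]
      exact mul_le_of_le_one_right (Finset.prod_nonneg fun _ _ => h0 _) (h1 _)
    rw [Fin.prod_univ_castSucc]
    refine (mul_le_of_le_one_right (Finset.prod_nonneg fun _ _ => Finset.prod_nonneg
      fun _ _ => h0 _) (Finset.prod_le_one (fun _ _ => h0 _) fun _ _ => h1 _)).trans ?_
    exact Finset.prod_le_prod (fun _ _ => Finset.prod_nonneg fun _ _ => h0 _)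
      fun i _ => hinner i.castSucc
  calc ∑ l ∈ tables (K + 1) n, ∏ i, ∏ j, g (l i j)
      ≤ ∑ l ∈ tables (K + 1) n, ∏ i, ∏ j, g (f l i j) := Finset.sum_le_sum fun l _ => hle l
    _ = ∑ l ∈ (tables (K + 1) n).image f, ∏ i, ∏ j, g (l i j) :=
        (Finset.sum_image (f := fun l : Fin K → Fin K → ℕ => ∏ i, ∏ j, g (l i j)) hf).symm
    _ ≤ ∑ l ∈ Fintype.piFinset fun _ : Fin K => Fintype.piFinset fun _ : Fin K =>
          Finset.range (n + 1), ∏ i, ∏ j, g (l i j) := by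
        refine Finset.sum_le_sum_of_subset_of_nonneg ?_
          fun _ _ _ => Finset.prod_nonneg fun _ _ => Finset.prod_nonneg fun _ _ => h0 _
        intro l hl
        obtain ⟨l', hl', rfl⟩ := Finset.mem_image.1 hl
        unfold tables at hl'
        have h2 := Fintype.mem_piFinset.1 (Finset.mem_filter.1 hl').1
        exact Fintype.mem_piFinset.2 fun i => Fintype.mem_piFinset.2 fun j =>
          Fintype.mem_piFinset.1 (h2 i.castSucc) j.castSucc
    _ = (∑ m ∈ Finset.range (n + 1), g m) ^ (K ^ 2) := by
        rw [← Finset.prod_univ_sum (fun _ : Fin K => Fintype.piFinset fun _ : Fin K =>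
          Finset.range (n + 1)) (fun _ r => ∏ j, g (r j))]
        simp only [← Finset.prod_univ_sum (fun _ : Fin K => Finset.range (n + 1)) (fun _ m => g m)]
        simp [← pow_mul, sq]

theorem sum_sum_eq_of_mem_tables {k n : ℕ} (hk : 0 < k) {l : Fin k → Fin k → ℕ}
    (hl : l ∈ tables k n) : ∑ i, ∑ j, l i j = n := by
  refine Nat.eq_of_mul_eq_mul_left hk ?_
  rw [Finset.mul_sum, Finset.sum_congr rfl fun i _ => (mem_tables.1 hl).1 i]
  simp

theorem row_entropy_le {k n : ℕ} (hk : 3 ≤ k) (hn : n ≠ 0) (r : Fin k → ℕ)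
    (hr : k * ∑ j, r j = n) :
    ∑ j, -((r j : ℝ) * Real.log (r j / n)) ≤ 2 * (n / k) * Real.log k -
      (k : ℝ) * Real.log (k - 1) / (k - 1) * (k / n) * ∑ j, ((r j : ℝ) - n / k ^ 2) ^ 2 := by
  have hk0 : (0 : ℝ) < k := by positivity
  have hn0 : (0 : ℝ) < n := by positivity
  have hr' : (k : ℝ) * ∑ j, (r j : ℝ) = n := by exact_mod_cast hr
  have hr'' : ∑ j, (r j : ℝ) = n / k := by rw [← hr']; field_simp
  have hs : ∑ j, (k : ℝ) * r j / n = 1 := by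
    rw [← Finset.sum_div, ← Finset.mul_sum, hr', div_self hn0.ne']
  have h := sum_sq_sub_le_log_add_sum_mul_log hk (fun j => (k : ℝ) * r j / n)
    (fun j => by positivity) hs
  set α := (k : ℝ) * Real.log (k - 1) / (k - 1)
  have e1 : ∀ j, (k : ℝ) * r j / n * Real.log (k * r j / n) =
      k / n * (r j * Real.log k + r j * Real.log (r j / n)) := by
    intro j
    rcases Nat.eq_zero_or_pos (r j) with h0 | h0
    · simp [h0]
    · have : (0 : ℝ) < r j := by exact_mod_cast h0
      rw [mul_div_assoc, Real.log_mul hk0.ne' (by positivity)]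
      ring
  have e2 : ∑ j, ((k : ℝ) * r j / n) ^ 2 - 1 / k =
      (k / n) ^ 2 * ∑ j, ((r j : ℝ) - n / k ^ 2) ^ 2 := by
    have : ∀ j, ((k : ℝ) * r j / n) ^ 2 =
        (k / n) ^ 2 * ((r j : ℝ) - n / k ^ 2) ^ 2 + 2 / n * r j - 1 / k ^ 2 := by
      intro j
      field_simp
      ring
    rw [Finset.sum_congr rfl fun j _ => this j, Finset.sum_sub_distrib, Finset.sum_add_distrib,
      ← Finset.mul_sum, ← Finset.mul_sum, hr'']
    simp only [Finset.sum_const, Finset.card_univ, Fintype.card_fin, nsmul_eq_mul]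
    field_simp
    ring
  simp only [e1] at h
  rw [e2, ← Finset.mul_sum, Finset.sum_add_distrib, ← Finset.sum_mul, hr''] at h
  have h2 := mul_le_mul_of_nonneg_left h (show 0 ≤ (n : ℝ) / k by positivity)
  set V := ∑ j, ((r j : ℝ) - n / k ^ 2) ^ 2
  set E := ∑ j, (r j : ℝ) * Real.log (r j / n)
  have e3 : (n : ℝ) / k * (α * ((k / n) ^ 2 * V)) = α * (k / n) * V := by
    field_simp
  have e4 : (n : ℝ) / k * (Real.log k + k / n * (n / k * Real.log k + E)) =
      2 * (n / k) * Real.log k + E := by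
    field_simp
    ring
  rw [e3, e4] at h2
  rw [Finset.sum_neg_distrib]
  linarith

theorem exp_entropy_le {k n : ℕ} (hk : 3 ≤ k) (hn : n ≠ 0) {l : Fin k → Fin k → ℕ}
    (hl : l ∈ tables k n) :
    ∏ i, ∏ j, Real.exp (-((l i j : ℝ) * Real.log (l i j / n))) ≤ (k : ℝ) ^ (2 * n) *
      Real.exp (-((k : ℝ) * Real.log (k - 1) / (k - 1) * (k / n) *
        ∑ i, ∑ j, ((l i j : ℝ) - n / k ^ 2) ^ 2)) := by
  have hk0 : (0 : ℝ) < k := by positivity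
  have h := Finset.sum_le_sum fun i (_ : i ∈ Finset.univ) =>
    row_entropy_le hk hn (l i) ((mem_tables.1 hl).1 i)
  rw [Finset.sum_sub_distrib] at h
  simp only [← Real.exp_sum]
  have e : (k : ℝ) ^ (2 * n) = Real.exp (∑ _i : Fin k, 2 * ((n : ℝ) / k) * Real.log k) := by
    simp only [Finset.sum_const, Finset.card_univ, Fintype.card_fin, nsmul_eq_mul]
    rw [show (k : ℝ) * (2 * (n / k) * Real.log k) = ((2 * n : ℕ) : ℝ) * Real.log k by
      push_cast; field_simp, Real.exp_nat_mul, Real.exp_log hk0]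
  rw [e, ← Real.exp_add, Finset.mul_sum]
  exact Real.exp_le_exp.2 (by linarith)

theorem rpow_le_exp {a b y x : ℝ} (hx : 0 < x) (hy : 0 ≤ y) (hb : 0 ≤ b) (hab : a ≤ b) :
    x ^ (-2 * a) * (x ^ 2 + y) ^ a ≤ Real.exp (b * (y / x ^ 2)) := by
  have h1 : 1 ≤ 1 + y / x ^ 2 := by
    have : 0 ≤ y / x ^ 2 := by positivity
    linarith
  calc x ^ (-2 * a) * (x ^ 2 + y) ^ a = (1 + y / x ^ 2) ^ a := by
        rw [show 1 + y / x ^ 2 = (x ^ 2)⁻¹ * (x ^ 2 + y) by field_simp,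
          Real.mul_rpow (by positivity) (by positivity), Real.inv_rpow (by positivity),
          ← Real.rpow_neg (by positivity), ← Real.rpow_natCast x 2, ← Real.rpow_mul hx.le]
        congr 2
        push_cast
        ring
    _ ≤ (1 + y / x ^ 2) ^ b := Real.rpow_le_rpow_of_exponent_le h1 hab
    _ ≤ (Real.exp (y / x ^ 2)) ^ b :=
        Real.rpow_le_rpow (by linarith) (by linarith [Real.add_one_le_exp (y / x ^ 2)]) hb
    _ = Real.exp (b * (y / x ^ 2)) := by rw [← Real.exp_mul, mul_comm]

theorem collision_sum_eq {k n : ℕ} (hk : 0 < k) (hn : n ≠ 0) {l : Fin k → Fin k → ℕ}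
    (hl : l ∈ tables k n) :
    1 - 2 / (k : ℝ) + ∑ i, ∑ j, ((l i j : ℝ) / n) ^ 2 =
      (1 - 1 / (k : ℝ)) ^ 2 + (∑ i, ∑ j, ((l i j : ℝ) - n / k ^ 2) ^ 2) / n ^ 2 := by
  have hk0 : (0 : ℝ) < k := by positivity
  have hn0 : (0 : ℝ) < n := by positivity
  have hs : ∑ i, ∑ j, (l i j : ℝ) = n := by
    exact_mod_cast sum_sum_eq_of_mem_tables hk hl
  have : ∀ i j, ((l i j : ℝ) / n) ^ 2 =
      ((l i j : ℝ) - n / k ^ 2) ^ 2 / n ^ 2 + 2 / (n * k ^ 2) * l i j - 1 / k ^ 4 := by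
    intro i j
    field_simp
    ring
  simp only [this, Finset.sum_sub_distrib, Finset.sum_add_distrib, ← Finset.mul_sum,
    ← Finset.sum_div, hs]
  simp only [Finset.sum_const, Finset.card_univ, Fintype.card_fin, nsmul_eq_mul]
  field_simp
  ring

theorem inv_sqrt_mul_exp_le {K w n l : ℝ} (hK : 0 < K) (hw : 0 < w) (hn : 0 < n) (hl : 0 ≤ l) :
    (√(l + 1))⁻¹ * Real.exp (-(K / n * (l - n * w) ^ 2)) ≤
      ((√(w / 2))⁻¹ + (√(K * w ^ 2 / 4))⁻¹) / √n := by
  have hsn : 0 < √n := Real.sqrt_pos.2 hn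
  rw [add_div, ← div_eq_inv_mul]
  rcases le_total (n * w / 2) l with h | h
  · have h1 : Real.exp (-(K / n * (l - n * w) ^ 2)) / √(l + 1) ≤ (√(w / 2))⁻¹ / √n := by
      rw [inv_eq_one_div, div_div, ← Real.sqrt_mul (by positivity)]
      refine div_le_div₀ zero_le_one (Real.exp_le_one_iff.2 ?_) (Real.sqrt_pos.2 (by positivity))
        (Real.sqrt_le_sqrt (by linarith))
      have : 0 ≤ K / n * (l - n * w) ^ 2 := by positivity
      linarith
    exact h1.trans (le_add_of_nonneg_right (by positivity))
  · have h1 : Real.exp (-(K / n * (l - n * w) ^ 2)) / √(l + 1) ≤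
        (√(K * w ^ 2 / 4))⁻¹ / √n := by
      rw [inv_eq_one_div, div_div, ← Real.sqrt_mul (by positivity)]
      have hz : 0 < K * w ^ 2 / 4 * n := by positivity
      have h2 : K * w ^ 2 / 4 * n ≤ K / n * (l - n * w) ^ 2 := by
        have : (n * w / 2) ^ 2 ≤ (l - n * w) ^ 2 := by
          have : 0 < n * w := by positivity
          nlinarith
        calc K * w ^ 2 / 4 * n = K / n * (n * w / 2) ^ 2 := by field_simp; ring
          _ ≤ _ := by gcongr
      have h3 : Real.exp (-(K / n * (l - n * w) ^ 2)) ≤ 1 / √(K * w ^ 2 / 4 * n) := by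
        refine (Real.exp_le_exp.2 (neg_le_neg h2)).trans ?_
        rw [Real.exp_neg, ← one_div]
        refine one_div_le_one_div_of_le (Real.sqrt_pos.2 hz) ?_
        have h4 := Real.add_one_le_exp (K * w ^ 2 / 4 * n)
        have h5 : √(K * w ^ 2 / 4 * n) ≤ K * w ^ 2 / 4 * n + 1 := by
          rw [Real.sqrt_le_left (by linarith)]
          nlinarith
        linarith
      refine le_trans (div_le_self (Real.exp_pos _).le ?_) h3
      exact Real.one_le_sqrt.2 (by linarith)
    exact h1.trans (le_add_of_nonneg_left (by positivity))

/-- The bound on a single term of the sum, as a product of weights over the entries. -/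
theorem term_le {k n : ℕ} (hk : 3 ≤ k) (hn : n ≠ 0) {c b : ℝ} (hb : 0 ≤ b) (hcb : c ≤ b)
    {l : Fin k → Fin k → ℕ} (hl : l ∈ tables k n) :
    (1 - 1 / (k : ℝ)) ^ (-2 * (n : ℝ) * c) *
      ((n.factorial : ℝ) / (∏ i, ∏ j, ((l i j).factorial : ℝ)) *
        (1 - 2 / (k : ℝ) + ∑ i, ∑ j, ((l i j : ℝ) / (n : ℝ)) ^ 2) ^ ((n : ℝ) * c)) ≤
    (k : ℝ) ^ (2 * n) * (Real.exp 1 * √n) * ∏ i, ∏ j, ((√((l i j : ℝ) + 1))⁻¹ *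
      Real.exp (-((k : ℝ) ^ 2 / (k - 1) * (Real.log (k - 1) - b / (k - 1)) / n *
        ((l i j : ℝ) - n / k ^ 2) ^ 2))) := by
  have hk3 : (3 : ℝ) ≤ k := by exact_mod_cast hk
  have hk0 : (0 : ℝ) < k := by linarith
  have hk1 : (0 : ℝ) < k - 1 := by linarith
  have hn0 : (0 : ℝ) < n := by positivity
  have hx : (0 : ℝ) < 1 - 1 / k := by
    rw [sub_pos, div_lt_one hk0]
    linarith
  set V := ∑ i, ∑ j, ((l i j : ℝ) - n / k ^ 2) ^ 2 with hV
  have hV0 : 0 ≤ V := Finset.sum_nonneg fun i _ => Finset.sum_nonneg fun j _ => sq_nonneg _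
  have h1 : (1 - 1 / (k : ℝ)) ^ (-2 * (n : ℝ) * c) *
      (1 - 2 / (k : ℝ) + ∑ i, ∑ j, ((l i j : ℝ) / (n : ℝ)) ^ 2) ^ ((n : ℝ) * c) ≤
      Real.exp (n * b * (V / n ^ 2 / (1 - 1 / (k : ℝ)) ^ 2)) := by
    rw [collision_sum_eq (by omega) hn hl, mul_assoc]
    exact rpow_le_exp hx (by positivity) (by positivity) (mul_le_mul_of_nonneg_left hcb hn0.le)
  have h2 := factorial_div_prod_le hn (fun q : Fin k × Fin k => l q.1 q.2)
    (by rw [Fintype.sum_prod_type]; exact sum_sum_eq_of_mem_tables (by omega) hl)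
  simp only [Fintype.prod_prod_type, Finset.prod_mul_distrib] at h2
  have h3 := exp_entropy_le hk hn hl
  rw [← hV] at h3
  set P := ∏ i, ∏ j, (√((l i j : ℝ) + 1))⁻¹
  have hP : 0 ≤ P := Finset.prod_nonneg fun i _ => Finset.prod_nonneg fun j _ => by positivity
  set α := (k : ℝ) * Real.log (k - 1) / (k - 1) with hα
  calc _ = ((n.factorial : ℝ) / (∏ i, ∏ j, ((l i j).factorial : ℝ))) *
      ((1 - 1 / (k : ℝ)) ^ (-2 * (n : ℝ) * c) *
      (1 - 2 / (k : ℝ) + ∑ i, ∑ j, ((l i j : ℝ) / (n : ℝ)) ^ 2) ^ ((n : ℝ) * c)) := by ring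
    _ ≤ (Real.exp 1 * √n * (P * ((k : ℝ) ^ (2 * n) * Real.exp (-(α * (k / n) * V))))) *
        Real.exp (n * b * (V / n ^ 2 / (1 - 1 / (k : ℝ)) ^ 2)) := by
        refine mul_le_mul (h2.trans ?_) h1 ?_ (by positivity)
        · gcongr
        · rw [collision_sum_eq (by omega) hn hl]
          positivity
    _ = (k : ℝ) ^ (2 * n) * (Real.exp 1 * √n) * (P * (Real.exp (-(α * (k / n) * V)) *
        Real.exp (n * b * (V / n ^ 2 / (1 - 1 / (k : ℝ)) ^ 2)))) := by ring
    _ = _ := by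
        simp only [Finset.prod_mul_distrib, ← Real.exp_sum]
        rw [← Real.exp_add]
        congr 3
        simp only [Finset.sum_neg_distrib, ← Finset.mul_sum]
        rw [← hV, hα, show (1 : ℝ) - 1 / k = (k - 1) / k by field_simp]
        field_simp
        ring

theorem weight_le {κ w n l : ℝ} (hκ : 0 < κ) (hw : 0 < w) (hn : 0 < n) (hl : 0 ≤ l) :
    (√(l + 1))⁻¹ * Real.exp (-(κ / n * (l - n * w) ^ 2)) ≤
      ((√(w / 2))⁻¹ + (√(κ / 2 * w ^ 2 / 4))⁻¹) / √n *
        Real.exp (-(√(κ / (2 * n)) ^ 2 * (l - n * w) ^ 2)) := by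
  rw [Real.sq_sqrt (by positivity)]
  have e : Real.exp (-(κ / n * (l - n * w) ^ 2)) =
      Real.exp (-(κ / 2 / n * (l - n * w) ^ 2)) *
        Real.exp (-(κ / (2 * n) * (l - n * w) ^ 2)) := by
    rw [← Real.exp_add]
    congr 1
    field_simp
    ring
  rw [e, ← mul_assoc]
  exact mul_le_mul_of_nonneg_right (inv_sqrt_mul_exp_le (half_pos hκ) hw hn hl) (Real.exp_pos _).le

/-- The explicit bound on `A k c n`. -/
theorem A_le {K : ℕ} (hK : 2 ≤ K) {c b κ w : ℝ} (hb : 0 ≤ b) (hcb : c ≤ b)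
    (hκ : κ = ((K + 1 : ℕ) : ℝ) ^ 2 / (((K + 1 : ℕ) : ℝ) - 1) *
      (Real.log (((K + 1 : ℕ) : ℝ) - 1) - b / (((K + 1 : ℕ) : ℝ) - 1)))
    (hκ0 : 0 < κ) (hw : w = 1 / ((K + 1 : ℕ) : ℝ) ^ 2) {n : ℕ} (hn : n ≠ 0) :
    A (K + 1) c n ≤ Real.exp 1 *
      (((√(w / 2))⁻¹ + (√(κ / 2 * w ^ 2 / 4))⁻¹) ^ ((K + 1) * (K + 1)) *
        (2 + 4 / √(κ / 2)) ^ (K ^ 2)) := by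
  have hn0 : (0 : ℝ) < n := by positivity
  have hn1 : (1 : ℝ) ≤ n := by exact_mod_cast Nat.pos_of_ne_zero hn
  have hw0 : 0 < w := by rw [hw]; positivity
  set C := (√(w / 2))⁻¹ + (√(κ / 2 * w ^ 2 / 4))⁻¹
  have hC : 0 ≤ C := by positivity
  set g : ℕ → ℝ := fun m => Real.exp (-(√(κ / (2 * n)) ^ 2 * ((m : ℝ) - n * w) ^ 2)) with hg
  set r := √(n : ℝ) with hr
  have hr1 : 1 ≤ r := Real.one_le_sqrt.2 hn1
  have hrr : r ^ 2 = n := Real.sq_sqrt hn0.le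
  have hterm : ∀ l ∈ tables (K + 1) n,
      (1 - 1 / ((K + 1 : ℕ) : ℝ)) ^ (-2 * (n : ℝ) * c) *
      ((n.factorial : ℝ) / (∏ i, ∏ j, ((l i j).factorial : ℝ)) *
        (1 - 2 / ((K + 1 : ℕ) : ℝ) + ∑ i, ∑ j, ((l i j : ℝ) / (n : ℝ)) ^ 2) ^ ((n : ℝ) * c)) ≤
      ((K + 1 : ℕ) : ℝ) ^ (2 * n) * (Real.exp 1 * r) *
        ((C / r) ^ ((K + 1) * (K + 1)) * ∏ i, ∏ j, g (l i j)) := by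
    intro l hl
    refine (term_le (by omega) hn hb hcb hl).trans ?_
    refine mul_le_mul_of_nonneg_left ?_ (by positivity)
    rw [← hκ]
    calc _ ≤ ∏ i, ∏ j, (C / r * g (l i j)) := by
          refine Finset.prod_le_prod (fun i _ => Finset.prod_nonneg fun j _ => by positivity)
            fun i _ => Finset.prod_le_prod (fun j _ => by positivity) fun j _ => ?_
          have := weight_le hκ0 hw0 hn0 (l := l i j) (Nat.cast_nonneg _)
          rw [show (n : ℝ) / ((K + 1 : ℕ) : ℝ) ^ 2 = n * w by rw [hw]; ring]
          exact this
      _ = _ := by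
          simp only [Finset.prod_mul_distrib, Finset.prod_const, Finset.card_univ,
            Fintype.card_fin, pow_mul]
  have hgsum : ∑ m ∈ Finset.range (n + 1), g m ≤ (2 + 4 / √(κ / 2)) * r := by
    have h := sum_range_exp_neg_sq_le (τ := √(κ / (2 * n))) (μ := n * w) (by positivity)
      (by positivity) (n + 1)
    refine h.trans ?_
    have e : √(κ / (2 * n)) = √(κ / 2) / r := by
      rw [hr, ← Real.sqrt_div (by positivity), div_div]
    have e2 : 2 * (1 + 2 / (√(κ / 2) / r)) = 2 + 4 / √(κ / 2) * r := by
      have : √(κ / 2) ≠ 0 := by positivity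
      field_simp
      ring
    rw [e, e2]
    linarith
  have hsum : ∑ l ∈ tables (K + 1) n, ∏ i, ∏ j, g (l i j) ≤
      ((2 + 4 / √(κ / 2)) * r) ^ (K ^ 2) := by
    refine (sum_tables_prod_le K n g (fun _ => (Real.exp_pos _).le) fun m => ?_).trans
      (pow_le_pow_left₀ (Finset.sum_nonneg fun _ _ => (Real.exp_pos _).le) hgsum _)
    exact Real.exp_le_one_iff.2 (neg_nonpos.2 (by positivity))
  unfold A
  rw [mul_assoc, Finset.mul_sum]
  calc _ ≤ (n : ℝ) ^ K / ((K + 1 : ℕ) : ℝ) ^ (2 * n) * ∑ l ∈ tables (K + 1) n,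
        ((K + 1 : ℕ) : ℝ) ^ (2 * n) * (Real.exp 1 * r) *
        ((C / r) ^ ((K + 1) * (K + 1)) * ∏ i, ∏ j, g (l i j)) :=
        mul_le_mul_of_nonneg_left (Finset.sum_le_sum hterm) (by positivity)
    _ = (n : ℝ) ^ K * (Real.exp 1 * r) * (C / r) ^ ((K + 1) * (K + 1)) *
        ∑ l ∈ tables (K + 1) n, ∏ i, ∏ j, g (l i j) := by
        rw [← Finset.mul_sum, ← Finset.mul_sum]
        field_simp
    _ ≤ (n : ℝ) ^ K * (Real.exp 1 * r) * (C / r) ^ ((K + 1) * (K + 1)) *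
        ((2 + 4 / √(κ / 2)) * r) ^ (K ^ 2) :=
        mul_le_mul_of_nonneg_left hsum (by positivity)
    _ = _ := by
        have hr0 : r ≠ 0 := by positivity
        rw [← hrr, div_pow, mul_pow, ← pow_mul]
        have : r ^ ((K + 1) * (K + 1)) = r ^ (2 * K) * r * r ^ (K ^ 2) := by ring
        rw [this]
        field_simp

theorem A_nonneg {k : ℕ} (hk : 3 ≤ k) (c : ℝ) (n : ℕ) : 0 ≤ A k c n := by
  have hk3 : (3 : ℝ) ≤ k := by exact_mod_cast hk
  have hk0 : (0 : ℝ) < k := by linarith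
  have h1 : (0 : ℝ) ≤ 1 - 1 / k := by
    rw [sub_nonneg, div_le_one hk0]
    linarith
  have h2 : (0 : ℝ) ≤ 1 - 2 / k := by
    rw [sub_nonneg, div_le_one hk0]
    linarith
  unfold A
  positivity

end AchlioptasNaor

theorem mainTheorem1 (k : ℕ) (hk : 3 ≤ k) (c : ℝ)
    (hc : c < ((k : ℝ) - 1) * Real.log ((k : ℝ) - 1)) :
    (fun n : ℕ => AchlioptasNaor.A k c n) =O[atTop ⊓ 𝓟 {n : ℕ | k ∣ n}] (fun _ : ℕ => (1 : ℝ)) := by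
  obtain ⟨K, rfl⟩ : ∃ K, k = K + 1 := ⟨k - 1, by omega⟩
  have hk3 : (3 : ℝ) ≤ ((K + 1 : ℕ) : ℝ) := by exact_mod_cast hk
  have hk1 : (0 : ℝ) < ((K + 1 : ℕ) : ℝ) - 1 := by linarith
  have hL : 0 < Real.log (((K + 1 : ℕ) : ℝ) - 1) := Real.log_pos (by linarith)
  have hκ0 : 0 < ((K + 1 : ℕ) : ℝ) ^ 2 / (((K + 1 : ℕ) : ℝ) - 1) *
      (Real.log (((K + 1 : ℕ) : ℝ) - 1) - max c 0 / (((K + 1 : ℕ) : ℝ) - 1)) := by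
    refine mul_pos (by positivity) (sub_pos.2 ?_)
    rw [div_lt_iff₀ hk1, mul_comm]
    exact max_lt hc (by positivity)
  obtain ⟨B, hB⟩ : ∃ B, ∀ n : ℕ, n ≠ 0 → AchlioptasNaor.A (K + 1) c n ≤ B :=
    ⟨_, fun n hn =>
      AchlioptasNaor.A_le (by omega) (le_max_right c 0) (le_max_left c 0) rfl hκ0 rfl hn⟩
  refine (Asymptotics.IsBigO.of_bound B ?_).mono inf_le_left
  filter_upwards [eventually_ne_atTop 0] with n hn
  rw [Real.norm_of_nonneg (AchlioptasNaor.A_nonneg hk c n), norm_one, mul_one]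
  exact hB n hn
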